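/- Let $S$ be a scheme, $\mathcal S=\mathrm{Sch}/S$, and let $\mathcal A$, $\mathcal X$ be categories fibred in groupoids over $\mathcal S$. Write $q:\mathcal A\to\mathcal S$ for the structure morphism and $\mathcal X(\mathcal A)$ for the category of $1$-morphisms $\mathcal A\to\mathcal X$ of fibred categories over $\mathcal S$ (functors strictly over $\mathcal S$). For $\tau\in\{\text{ét},\mathrm{fppf}\}$ equip $\mathcal S$ with the big $\tau$-topology and every category fibred in groupoids $p:\mathcal T\to\mathcal S$ with the inherited topology (a family is a covering iff its image in $\mathcal S$ is one). Let $\mathrm{Sh}(\mathcal T_\tau)$ be the topos of sheaves. A $1$-morphism $f:\mathcal T'\to\mathcal T$ over $\mathcal S$ induces a morphism of topoi $f=(f_*,f^*):\mathrm{Sh}(\mathcal T'_\tau)\to\mathrm{Sh}(\mathcal T_\tau)$, where $f^*$ is composition with $f$. For a sheaf $\mathscr G$ of groups on $\mathcal S_\tau$, write $\mathscr G_{\mathcal T}=p^*\mathscr G$; then $f^*\mathscr G_{\mathcal T}=\mathscr G_{\mathcal T'}$. Define three kinds of full subcategories of $\mathcal X(\mathcal A)$. 1. *Derived obstruction.*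 $x\in\mathcal X(\mathcal A)^{\mathrm{Sh}_\tau}$ if and only if there are a morphism of topoi $x_0:\mathrm{Sh}(\mathcal S_\tau)\to\mathrm{Sh}(\mathcal X_\tau)$ over $\mathrm{Sh}(\mathcal S_\tau)$, in the strict sense that $x_0^*p_{\mathcal X}^*=\mathrm{id}$ (where $p_{\mathcal X}:\mathcal X\to\mathcal S$ is the structure morphism), and a $2$-isomorphism $x\Rightarrow x_0q$ over $\mathrm{Sh}(\mathcal S_\tau)$, that is, an isomorphism of functors $q^*x_0^*\cong x^*$ which at every object of the form $p_{\mathcal X}^*\mathscr F$, $\mathscr F\in\mathrm{Sh}(\mathcal S_\tau)$, is the identity of $q^*\mathscr F$. 2. *Generalized descent obstruction.* $x\in\mathcal X(\mathcal A)^{\mathrm{desc}}$ if and only if for every sheaf of groups $\mathscr G$ on $\mathcal S_{\mathrm{fppf}}$ and every (right) $\mathscr G_{\mathcal X}$-torsor $\mathscr Y$ on $\mathcal X_{\mathrm{fppf}}$, the class of $x^*\mathscr Y$ lies in the image of $q^*:\mathsf H^1_{\mathrm{fppf}}(\mathcal S,\mathscr G)\to\mathsf H^1_{\mathrm{fppf}}(\mathcal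 A,\mathscr G_{\mathcal A})$, where $\mathsf H^1_{\mathrm{fppf}}(\mathcal T,-)$ denotes the set of isomorphism classes of torsors on $\mathcal T_{\mathrm{fppf}}$. 3. *$i$-th $\tau$-descent category*, $i\ge 0$. $x\in\mathcal X(\mathcal A)^{i\text{-}\mathrm{desc}_\tau}$ if and only if for every abelian sheaf $\mathscr G$ on $\mathcal S_\tau$ and every $A\in H^i_\tau(\mathcal X,\mathscr G_{\mathcal X})$, the class $x^*A\in H^i_\tau(\mathcal A,\mathscr G_{\mathcal A})$ lies in the image of $q^*:H^i_\tau(\mathcal S,\mathscr G)\to H^i_\tau(\mathcal A,\mathscr G_{\mathcal A})$. Then $$\mathcal X(\mathcal A)^{\mathrm{Sh}_{\mathrm{fppf}}}\subseteq\mathcal X(\mathcal A)^{\mathrm{desc}},$$ and for $\tau\in\{\text{ét},\mathrm{fppf}\}$ and all $i\ge 0$ $$\mathcal X(\mathcal A)^{\mathrm{Sh}_\tau}\subseteq\mathcal X(\mathcal A)^{i\text{-}\mathrm{desc}_\tau}.$$ -/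

import Mathlib

universe u v w v₁ v₂ v₃ u₁ u₂ u₃

open CategoryTheory Limits MonoidalCategory CartesianMonoidalCategory

namespace DerivedObstruction

/-- A functor `p : X ⥤ C` is fibred in groupoids: it is a fibred category all of whose fibres are
groupoids. -/
class IsFiberedInGroupoids {C : Type u₁} [Category.{v₁} C] {X : Type u₂} [Category.{v₂} X]
    (p : X ⥤ C) : Prop extends p.IsFibered where
  isGroupoid_fiber (U : C) : IsGroupoid (p.Fiber U)

/-- The elementary lifting properties of a category fibred in groupoids, up to isomorphism in the
base. They are used only to construct the inherited topology and the morphisms of topoi. -/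
structure LiftsUniquely {C : Type u₁} [Category.{v₁} C] {X : Type u₂} [Category.{v₂} X]
    (p : X ⥤ C) : Prop where
  lift {y : X} {U : C} (h : U ⟶ p.obj y) :
    ∃ (x : X) (φ : x ⟶ y) (e : U ≅ p.obj x), e.hom ≫ p.map φ = h
  fac {x y z : X} (g : y ⟶ z) (f : x ⟶ z) (k : p.obj x ⟶ p.obj y) (h : k ≫ p.map g = p.map f) :
    ∃ φ : x ⟶ y, φ ≫ g = f ∧ p.map φ = k
  uniq {x y z : X} (g : y ⟶ z) (a b : x ⟶ y) (h : a ≫ g = b ≫ g) (hp : p.map a = p.map b) : a = b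

section
variable {C : Type u₁} [Category.{v₁} C] {X : Type u₂} [Category.{v₂} X] {Y : Type u₃}
  [Category.{v₃} Y]

lemma isStronglyCartesian (p : X ⥤ C) [IsFiberedInGroupoids p] {a b : X} (φ : a ⟶ b) :
    p.IsStronglyCartesian (p.map φ) φ := by
  let ψ := Functor.IsPreFibered.pullbackMap (p := p) rfl (p.map φ)
  let τ := Functor.IsCartesian.map p (p.map φ) ψ φ
  have := IsFiberedInGroupoids.isGroupoid_fiber (p := p) (p.obj a)
  have hτ : IsIso τ := by
    have : IsIso (Functor.Fiber.homMk p (p.obj a) τ) := IsGroupoid.all_isIso _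
    have : IsIso (Functor.Fiber.fiberInclusion.map (Functor.Fiber.homMk p (p.obj a) τ)) :=
      inferInstance
    simpa using this
  have h : τ ≫ ψ = φ := Functor.IsCartesian.fac p (p.map φ) ψ φ
  have hl : p.IsHomLift (𝟙 (p.obj a)) (asIso τ).hom := by
    simpa using Functor.IsCartesian.map_isHomLift p (p.map φ) ψ φ
  have h2 := Functor.IsCartesian.of_iso_comp p (p.map φ) ψ (asIso τ)
  rw [asIso_hom, h] at h2
  infer_instance

lemma liftsUniquely_of_isFiberedInGroupoids (p : X ⥤ C) [IsFiberedInGroupoids p] :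
    LiftsUniquely p where
  lift {y U} h := by
    obtain ⟨x, φ, hφ⟩ := IsPreFibered.exists_isCartesian p rfl h
    have hd := IsHomLift.domain_eq p h φ
    subst hd
    refine ⟨x, φ, Iso.refl _, ?_⟩
    simpa using (IsHomLift.eq_of_isHomLift p h φ).symm
  fac {x y z} g f k h := by
    have := isStronglyCartesian p g
    refine ⟨Functor.IsStronglyCartesian.map p (p.map g) g h.symm f, ?_, ?_⟩
    · simp
    · exact (IsHomLift.eq_of_isHomLift p _ _).symm
  uniq {x y z} g a b h hp := by
    have := isStronglyCartesian p g
    have : p.IsHomLift (p.map a) b := by rw [hp]; infer_instance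
    exact Functor.IsStronglyCartesian.ext p (p.map g) g (p.map a) h

lemma LiftsUniquely.isIso {p : X ⥤ C} (hp : LiftsUniquely p) {a b : X} (φ : a ⟶ b)
    [IsIso (p.map φ)] : IsIso φ := by
  obtain ⟨ψ, h₁, h₂⟩ := hp.fac φ (𝟙 b) (inv (p.map φ)) (by simp)
  refine ⟨ψ, ?_, h₁⟩
  exact hp.uniq φ _ _ (by simp [h₁]) (by simp [h₂])

lemma LiftsUniquely.of_comp {f : Y ⥤ X} {p : X ⥤ C} {q : Y ⥤ C} (w : f ⋙ p = q)
    (hp : LiftsUniquely p) (hq : LiftsUniquely q) : LiftsUniquely f := by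
  subst w
  refine ⟨?_, ?_, ?_⟩
  · intro y U h
    obtain ⟨x, φ, e, he⟩ := hq.lift (p.map h)
    obtain ⟨χ, h₁, h₂⟩ := hp.fac (f.map φ) h e.hom he
    have : IsIso (p.map χ) := by rw [h₂]; infer_instance
    have := hp.isIso χ
    exact ⟨x, φ, asIso χ, h₁⟩
  · intro x y z g f' k h
    obtain ⟨φ, h₁, h₂⟩ := hq.fac g f' (p.map k) (by simp [← h])
    exact ⟨φ, h₁, hp.uniq (f.map g) _ _ (by rw [h, ← f.map_comp, h₁]) h₂⟩
  · intro x y z g a b h hab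
    exact hq.uniq g a b h (by simp [hab])

lemma LiftsUniquely.functorPullback_functorPushforward {p : X ⥤ C} (hp : LiftsUniquely p) {x : X}
    (S : Sieve (p.obj x)) : (S.functorPullback p).functorPushforward p = S := by
  apply le_antisymm
  · rw [Sieve.functorPushforward_le_iff_le_functorPullback]
  · intro U h hS
    obtain ⟨y, φ, e, rfl⟩ := hp.lift h
    refine ⟨y, φ, e.hom, ?_, rfl⟩
    have := S.downward_closed hS e.inv
    simpa using this

lemma LiftsUniquely.map_mem_functorPushforward {p : X ⥤ C} (hp : LiftsUniquely p) {x y : X}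
    (S : Sieve x) (f : y ⟶ x) : S.functorPushforward p (p.map f) ↔ S f := by
  constructor
  · rintro ⟨z, g, k, hg, h⟩
    obtain ⟨φ, rfl, -⟩ := hp.fac g f k h.symm
    exact S.downward_closed hg φ
  · exact Sieve.image_mem_functorPushforward p S

lemma LiftsUniquely.functorPushforward_pullback {p : X ⥤ C} (hp : LiftsUniquely p) {x y : X}
    (S : Sieve x) (f : y ⟶ x) :
    (S.pullback f).functorPushforward p = (S.functorPushforward p).pullback (p.map f) := by
  rw [← hp.functorPullback_functorPushforward ((S.functorPushforward p).pullback (p.map f))]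
  congr 1
  ext z g
  change S (g ≫ f) ↔ S.functorPushforward p (p.map g ≫ p.map f)
  rw [← p.map_comp, hp.map_mem_functorPushforward]

/-- The topology on a category `p : X ⥤ C` fibred in groupoids inherited from a topology `J` on `C`:
a sieve on `x` is covering if and only if the sieve on `p x` generated by its image is covering. -/
def inheritedTopology (p : X ⥤ C) [IsFiberedInGroupoids p] (J : GrothendieckTopology C) :
    GrothendieckTopology X where
  sieves x := {S | S.functorPushforward p ∈ J (p.obj x)}
  top_mem' x := by
    change Sieve.functorPushforward p ⊤ ∈ J (p.obj x)
    rw [Sieve.functorPushforward_top]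
    exact J.top_mem _
  pullback_stable' x y S f hS := by
    change (S.pullback f).functorPushforward p ∈ J (p.obj y)
    rw [(liftsUniquely_of_isFiberedInGroupoids p).functorPushforward_pullback]
    exact J.pullback_stable _ hS
  transitive' x S hS R hR := by
    refine J.transitive hS _ ?_
    rintro U _ ⟨y, g, k, hg, rfl⟩
    rw [Sieve.pullback_comp]
    apply J.pullback_stable
    rw [← (liftsUniquely_of_isFiberedInGroupoids p).functorPushforward_pullback]
    exact hR hg

lemma mem_inheritedTopology (p : X ⥤ C) [IsFiberedInGroupoids p] (J : GrothendieckTopology C)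
    {x : X} (S : Sieve x) :
    S ∈ inheritedTopology p J x ↔ S.functorPushforward p ∈ J (p.obj x) := Iff.rfl

lemma mem_inheritedTopology_iff_of_comp {f : Y ⥤ X} {p : X ⥤ C} {q : Y ⥤ C}
    [IsFiberedInGroupoids p] [IsFiberedInGroupoids q] (w : f ⋙ p = q)
    (J : GrothendieckTopology C) {y : Y} (S : Sieve y) :
    S ∈ inheritedTopology q J y ↔ S.functorPushforward f ∈ inheritedTopology p J (f.obj y) := by
  subst w
  simp only [mem_inheritedTopology, Sieve.functorPushforward_comp]
  rfl

lemma LiftsUniquely.isCocontinuous {p : X ⥤ C} (hp : LiftsUniquely p) {J : GrothendieckTopology X}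
    {K : GrothendieckTopology C}
    (h : ∀ {x : X} (S : Sieve x), S ∈ J x ↔ S.functorPushforward p ∈ K (p.obj x)) :
    p.IsCocontinuous J K where
  cover_lift hS := by rwa [h, hp.functorPullback_functorPushforward]

lemma LiftsUniquely.isContinuous {p : X ⥤ C} (hp : LiftsUniquely p) {J : GrothendieckTopology X}
    {K : GrothendieckTopology C}
    (h : ∀ {x : X} (S : Sieve x), S ∈ J x ↔ S.functorPushforward p ∈ K (p.obj x)) :
    p.IsContinuous J K := by
  refine Functor.isContinuous_of_coverPreserving ⟨?_⟩ ⟨fun hS => (h _).1 hS⟩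
  intro ℱ Z T x hx Y₁ Y₂ U f₁ f₂ g₁ g₂ hg₁ hg₂ e
  obtain ⟨W, φ, i, rfl⟩ := hp.lift f₁
  obtain ⟨ψ, h₁, h₂⟩ := hp.fac g₂ (φ ≫ g₁) (i.inv ≫ f₂) (by simp [← e])
  obtain rfl : f₂ = i.hom ≫ p.map ψ := by simp [h₂]
  have := hx φ ψ hg₁ hg₂ h₁.symm
  simp only [op_comp, ℱ.obj.map_comp]
  exact congrArg _ this

end

/-- A morphism of topoi `f = (f_*, f^*) : E ⟶ F`: the direct image `f_* : E ⥤ F`, and the inverse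
image `f^* : F ⥤ E`, which is left adjoint to `f_*` and preserves finite limits. -/
structure GeomMorphism (E : Type u₁) [Category.{v₁} E] (F : Type u₂) [Category.{v₂} F] where
  direct : E ⥤ F
  inverse : F ⥤ E
  adj : inverse ⊣ direct
  preservesFiniteLimits : PreservesFiniteLimits inverse

attribute [instance] GeomMorphism.preservesFiniteLimits

/-- A 1-morphism `f` from `x : E ⟶ B` to `y : F ⟶ B` in the modified 2-category of topoi over `B`:
a morphism of topoi `f : E ⟶ F` with the strict equality `f^* y^* = x^*`; the 2-isomorphism
`y f ⟹ x` that is part of a 1-morphism is then given by the identity of `x^*`. -/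
structure GeomMorphismOver {B : Type u₁} [Category.{v₁} B] {E : Type u₂} [Category.{v₂} E]
    {F : Type u₃} [Category.{v₃} F] (x : GeomMorphism E B) (y : GeomMorphism F B)
    extends GeomMorphism E F where
  comm : y.inverse ⋙ inverse = x.inverse

namespace GeomMorphismOver

variable {B : Type u₁} [Category.{v₁} B] {E E' E'' : Type u₂} [Category.{v₂} E]
  [Category.{v₂} E'] [Category.{v₂} E''] {x : GeomMorphism E B} {y : GeomMorphism E' B}
  {z : GeomMorphism E'' B}

/-- Composition of 1-morphisms over `B`; on inverse images this is `f^* g^*`. -/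
def comp (f : GeomMorphismOver x y) (g : GeomMorphismOver y z) : GeomMorphismOver x z where
  direct := f.direct ⋙ g.direct
  inverse := g.inverse ⋙ f.inverse
  adj := g.adj.comp f.adj
  preservesFiniteLimits := comp_preservesFiniteLimits _ _
  comm := by rw [← Functor.assoc, g.comm, f.comm]

/-- A 2-isomorphism `ξ : f ⟹ g` between 1-morphisms over `B`: an isomorphism of functors
`ξ^* : g^* ≅ f^*` compatible with the identifications `f^* y^* = x^* = g^* y^*`, that is,
whose restriction to objects `y^* b` is the identity of `x^* b`. -/
structure TwoIso (f g : GeomMorphismOver x y) where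
  iso : g.inverse ≅ f.inverse
  compat (b : B) : iso.hom.app (y.inverse.obj b) =
    eqToHom (Functor.congr_obj (g.comm.trans f.comm.symm) b)

end GeomMorphismOver

section Torsors

variable {E : Type u₁} [Category.{v₁} E] [CartesianMonoidalCategory E]
  {F : Type u₂} [Category.{v₂} F] [CartesianMonoidalCategory F]

open MonObj

/-- A right torsor (over the final object) under a group object `G`: an object `X` with a right
action of `G`, such that `X ⟶ 1` is an epimorphism and `X × G ⟶ X × X`, `(x, g) ↦ (x, x g)`, is an
isomorphism. -/
structure Torsor (G : Grp E) where
  X : E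
  act : X ⊗ G.X ⟶ X
  act_one : X ◁ (η : 𝟙_ E ⟶ G.X) ≫ act = (ρ_ X).hom
  act_mul : act ▷ G.X ≫ act = (α_ X G.X G.X).hom ≫ X ◁ (μ : G.X ⊗ G.X ⟶ G.X) ≫ act
  epi : Epi (toUnit X)
  isIso : IsIso (lift (fst X G.X) act)

namespace Torsor

/-- An isomorphism of `G`-torsors: an isomorphism of the underlying objects compatible with the
actions. -/
structure Iso {G : Grp E} (P Q : Torsor G) where
  iso : P.X ≅ Q.X
  equivariant : P.act ≫ iso.hom = iso.hom ▷ G.X ≫ Q.act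

/-- Transport of a torsor along an isomorphism of groups. -/
@[simps]
def changeGroup {G H : Grp E} (P : Torsor G) (e : G ≅ H) : Torsor H where
  X := P.X
  act := P.X ◁ e.inv.hom.hom ≫ P.act
  act_one := by
    rw [← MonoidalCategory.whiskerLeft_comp_assoc, IsMonHom.one_hom, P.act_one]
  act_mul := by
    have h : μ[H.X] ≫ e.inv.hom.hom = (e.inv.hom.hom ⊗ₘ e.inv.hom.hom) ≫ μ[G.X] :=
      IsMonHom.mul_hom _
    rw [← MonoidalCategory.whiskerLeft_comp_assoc, h, comp_whiskerRight, Category.assoc,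
      ← whisker_exchange_assoc, P.act_mul, MonoidalCategory.tensorHom_def]
    simp
  epi := P.epi
  isIso := by
    have := P.isIso
    have h : lift (fst P.X H.X) (P.X ◁ e.inv.hom.hom ≫ P.act) =
        P.X ◁ e.inv.hom.hom ≫ lift (fst P.X G.X) P.act := by
      ext <;> simp
    rw [h]
    infer_instance

section

variable {G : Grp E} (P : Torsor G) (Φ : E ⥤ F) [Φ.Monoidal]

open Functor.LaxMonoidal Functor.Monoidal

lemma map_act_one :
    Φ.obj P.X ◁ (ε Φ ≫ Φ.map η[G.X]) ≫ Functor.LaxMonoidal.μ Φ P.X G.X ≫ Φ.map P.act =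
      (ρ_ (Φ.obj P.X)).hom := by
  rw [MonoidalCategory.whiskerLeft_comp, Category.assoc, μ_natural_right_assoc, ← Φ.map_comp,
    P.act_one, ← Functor.LaxMonoidal.right_unitality]

lemma map_act_mul :
    (Functor.LaxMonoidal.μ Φ P.X G.X ≫ Φ.map P.act) ▷ Φ.obj G.X ≫
        Functor.LaxMonoidal.μ Φ P.X G.X ≫ Φ.map P.act =
      (α_ (Φ.obj P.X) (Φ.obj G.X) (Φ.obj G.X)).hom ≫
        Φ.obj P.X ◁ (Functor.LaxMonoidal.μ Φ G.X G.X ≫ Φ.map μ[G.X]) ≫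
          Functor.LaxMonoidal.μ Φ P.X G.X ≫ Φ.map P.act := by
  rw [comp_whiskerRight, MonoidalCategory.whiskerLeft_comp, Category.assoc, Category.assoc,
    μ_natural_left_assoc, μ_natural_right_assoc, ← Φ.map_comp, P.act_mul, Φ.map_comp, Φ.map_comp,
    Functor.LaxMonoidal.associativity_assoc]

lemma epi_toUnit_map [Φ.PreservesEpimorphisms] : Epi (toUnit (Φ.obj P.X)) := by
  have := P.epi
  have h : toUnit (Φ.obj P.X) = Φ.map (toUnit P.X) ≫ (εIso Φ).inv := toUnit_unique _ _
  rw [h]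
  infer_instance

lemma isIso_map : IsIso (lift (fst (Φ.obj P.X) (Φ.obj G.X))
    (Functor.LaxMonoidal.μ Φ P.X G.X ≫ Φ.map P.act)) := by
  have := P.isIso
  have h : lift (fst (Φ.obj P.X) (Φ.obj G.X)) (Functor.LaxMonoidal.μ Φ P.X G.X ≫ Φ.map P.act) =
      (μIso Φ P.X G.X).hom ≫ Φ.map (lift (fst P.X G.X) P.act) ≫ (μIso Φ P.X P.X).inv := by
    ext <;> simp
  rw [h]
  infer_instance

end

/-- The image of a `G`-torsor under a functor preserving finite products and epimorphisms. -/
@[simps]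
noncomputable def map {G : Grp E} (P : Torsor G) (Φ : E ⥤ F) [Φ.Monoidal]
    [Φ.PreservesEpimorphisms] : Torsor (Φ.mapGrp.obj G) where
  X := Φ.obj P.X
  act := Functor.LaxMonoidal.μ Φ P.X G.X ≫ Φ.map P.act
  act_one := P.map_act_one Φ
  act_mul := P.map_act_mul Φ
  epi := P.epi_toUnit_map Φ
  isIso := P.isIso_map Φ

lemma Iso.changeGroup_nonempty {G H : Grp E} {P Q : Torsor G} (i : Iso P Q) (e : G ≅ H) :
    Nonempty (Iso (P.changeGroup e) (Q.changeGroup e)) := by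
  refine ⟨{ iso := i.iso, equivariant := ?_ }⟩
  have : (P.X ◁ e.inv.hom.hom ≫ P.act) ≫ i.iso.hom =
      i.iso.hom ▷ H.X ≫ Q.X ◁ e.inv.hom.hom ≫ Q.act := by
    rw [Category.assoc, i.equivariant, whisker_exchange_assoc]
  exact this

lemma Iso.map_nonempty {G : Grp E} {P Q : Torsor G} (i : Iso P Q) (Φ : E ⥤ F) [Φ.Monoidal]
    [Φ.PreservesEpimorphisms] : Nonempty (Iso (P.map Φ) (Q.map Φ)) := by
  refine ⟨{ iso := Φ.mapIso i.iso, equivariant := ?_ }⟩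
  have : (Functor.LaxMonoidal.μ Φ P.X G.X ≫ Φ.map P.act) ≫ Φ.map i.iso.hom =
      Φ.map i.iso.hom ▷ Φ.obj G.X ≫ Functor.LaxMonoidal.μ Φ Q.X G.X ≫ Φ.map Q.act := by
    rw [Category.assoc, ← Φ.map_comp, i.equivariant, Functor.LaxMonoidal.μ_natural_left_assoc,
      Φ.map_comp]
  exact this

/-- Being isomorphic, as an equivalence relation on `G`-torsors. -/
instance setoid (G : Grp E) : Setoid (Torsor G) where
  r P Q := Nonempty (Iso P Q)
  iseqv :=
    { refl P := ⟨⟨CategoryTheory.Iso.refl _, by simp⟩⟩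
      symm := fun ⟨i⟩ => ⟨⟨i.iso.symm, by
        rw [CategoryTheory.Iso.symm_hom, Iso.comp_inv_eq, Category.assoc, i.equivariant,
          ← comp_whiskerRight_assoc]
        simp⟩⟩
      trans := fun ⟨i⟩ ⟨j⟩ => ⟨⟨i.iso ≪≫ j.iso, by
        simp [← j.equivariant, reassoc_of% i.equivariant]⟩⟩ }

end Torsor

/-- The set of isomorphism classes of `G`-torsors. -/
def H1 (G : Grp E) : Type max u₁ v₁ := Quotient (Torsor.setoid G)

end Torsors

section
variable {B : Type u₁} [Category.{v₁} B] [CartesianMonoidalCategory B]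
  {E E' : Type u₂} [Category.{v₂} E] [CartesianMonoidalCategory E]
  [Category.{v₂} E'] [CartesianMonoidalCategory E']

noncomputable instance (f : GeomMorphism E B) : f.inverse.Monoidal :=
  .ofChosenFiniteProducts _

instance (f : GeomMorphism E B) : f.inverse.PreservesEpimorphisms :=
  Functor.preservesEpimorphisms_of_adjunction f.adj

/-- The pull-back `x^* G` of a group object. -/
noncomputable abbrev GeomMorphism.pullbackGrp (x : GeomMorphism E B) (G : Grp B) : Grp E :=
  x.inverse.mapGrp.obj G

/-- The identification `f^* (y^* G) ≅ x^* G` given by `f^* y^* = x^*`. -/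
noncomputable def GeomMorphismOver.pullbackGrpIso {x : GeomMorphism E B} {y : GeomMorphism E' B}
    (f : GeomMorphismOver x y) (G : Grp B) :
    f.inverse.mapGrp.obj (y.pullbackGrp G) ≅ x.pullbackGrp G :=
  (Functor.mapGrpCompIso.symm ≪≫ Functor.mapGrpNatIso (eqToIso f.comm)).app G

/-- The pull-back of torsors `H¹(E', G_{E'}) → H¹(E, G_E)`, `[P] ↦ [f^* P]`, where `G_E = x^* G` and
`G_{E'} = y^* G`. -/
noncomputable def GeomMorphismOver.pullbackH1 {x : GeomMorphism E B} {y : GeomMorphism E' B}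
    (f : GeomMorphismOver x y) (G : Grp B) : H1 (y.pullbackGrp G) → H1 (x.pullbackGrp G) :=
  Quotient.map (fun P => (P.map f.inverse).changeGroup (f.pullbackGrpIso G)) (by
    rintro P Q ⟨i⟩
    obtain ⟨j⟩ := i.map_nonempty f.inverse
    exact j.changeGroup_nonempty _)

end

section Sites

variable {C D : Type (u + 1)} [Category.{u} C] [Category.{u} D] (F : C ⥤ D)
  (J : GrothendieckTopology C) (K : GrothendieckTopology D)
  [F.IsContinuous J K]

lemma preservesFiniteLimits_sheafPushforwardContinuous (A : Type w) [Category.{v} A]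
    [HasFiniteLimits A] :
    PreservesFiniteLimits (F.sheafPushforwardContinuous A J K) where
  preservesFiniteLimits I _ _ :=
    have : PreservesLimitsOfShape I (F.sheafPushforwardContinuous A J K ⋙ sheafToPresheaf J A) :=
      inferInstanceAs (PreservesLimitsOfShape I
        (sheafToPresheaf K A ⋙ (Functor.whiskeringLeft _ _ A).obj F.op))
    preservesLimitsOfShape_of_reflects_of_preserves _ (sheafToPresheaf J A)

instance : PreservesFiniteLimits (F.sheafPushforwardContinuous AddCommGrpCat.{u + 1} J K) :=
  preservesFiniteLimits_sheafPushforwardContinuous F J K _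

instance : (F.sheafPushforwardContinuous AddCommGrpCat.{u + 1} J K).Additive where
  map_add := rfl

/-- The morphism of topoi induced by a continuous and cocontinuous functor `F`: the inverse image is
composition with `F`, and the direct image is its right adjoint. -/
noncomputable def GeomMorphism.ofSites [F.IsCocontinuous J K] :
    GeomMorphism (Sheaf J (Type (u + 1))) (Sheaf K (Type (u + 1))) where
  direct := F.sheafPushforwardCocontinuous _ J K
  inverse := F.sheafPushforwardContinuous _ J K
  adj := F.sheafAdjunctionCocontinuous _ J K
  preservesFiniteLimits := preservesFiniteLimits_sheafPushforwardContinuous F J K _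

lemma preservesFiniteColimits_sheafPushforwardContinuous [F.IsCocontinuous J K] :
    PreservesFiniteColimits (F.sheafPushforwardContinuous AddCommGrpCat.{u + 1} J K) :=
  have := (F.sheafAdjunctionCocontinuous AddCommGrpCat.{u + 1} J K).leftAdjoint_preservesColimits
  inferInstance

/-- `Ext` groups between abelian sheaves on a site `C` with `Type (u + 1)` many objects live in
`Type (u + 1)`. -/
instance : HasExt.{u + 1} (Sheaf J AddCommGrpCat.{u + 1}) :=
  have : EssentiallySmall.{u + 1} C := by infer_instance
  have : IsGrothendieckAbelian.{u + 1} (Sheaf J AddCommGrpCat.{u + 1}) :=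
    Sheaf.isGrothendieckAbelian_of_essentiallySmall J AddCommGrpCat.{u + 1}
  hasExt_of_enoughInjectives _

/-- The identification of the constant sheaf with the pull-back of the constant sheaf. -/
noncomputable def constantSheafPullbackIso [F.IsCocontinuous J K] (M : AddCommGrpCat.{u + 1}) :
    (constantSheaf J _).obj M ≅
      (F.sheafPushforwardContinuous AddCommGrpCat.{u + 1} J K).obj ((constantSheaf K _).obj M) :=
  (F.pushforwardContinuousSheafificationCompatibility AddCommGrpCat.{u + 1} J K).app
    ((Functor.const _).obj M)

/-- The pull-back `Hⁱ(D, G) → Hⁱ(C, F^* G)`: it is the map `Ext^i(ℤ_D, G) → Ext^i(ℤ_C, F^* G)` induced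
by the exact functor `F^*` and the identification `F^* ℤ_D = ℤ_C`. -/
noncomputable def sitePullbackH [F.IsCocontinuous J K] (G : Sheaf K AddCommGrpCat.{u + 1}) (i : ℕ)
    (A : G.H i) : ((F.sheafPushforwardContinuous AddCommGrpCat.{u + 1} J K).obj G).H i :=
  have := preservesFiniteColimits_sheafPushforwardContinuous F J K
  (Abelian.Ext.mk₀ (constantSheafPullbackIso F J K _).hom).comp
    (A.mapExactFunctor (F.sheafPushforwardContinuous AddCommGrpCat.{u + 1} J K)) (zero_add i)

end Sites

section Fibred

open BasedFunctor

instance {C : Type u₁} [Category.{v₁} C] : IsFiberedInGroupoids (𝟭 C) where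
  toIsFibered := .of_exists_isStronglyCartesian fun a R f => by
    refine ⟨R, f, { toIsHomLift := inferInstanceAs ((𝟭 C).IsHomLift ((𝟭 C).map f) f)
                    universal_property' := ?_ }⟩
    intro a' g φ' hφ
    have h1 : g ≫ f = φ' := IsHomLift.eq_of_isHomLift (𝟭 C) (g ≫ f) φ'
    exact ⟨g, ⟨inferInstanceAs ((𝟭 C).IsHomLift ((𝟭 C).map g) g), h1⟩, fun χ hχ =>
      have := hχ.1
      (IsHomLift.eq_of_isHomLift (𝟭 C) g χ).symm⟩
  isGroupoid_fiber U := by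
    refine ⟨fun {a b} f => ?_⟩
    obtain ⟨a, rfl⟩ := a
    obtain ⟨b, hb⟩ := b
    obtain ⟨f, hf⟩ := f
    change b = a at hb
    subst hb
    have h : 𝟙 b = f :=
      have : (𝟭 C).IsHomLift (𝟙 ((𝟭 C).obj b)) f := hf
      IsHomLift.eq_of_isHomLift (𝟭 C) (𝟙 ((𝟭 C).obj b)) f
    subst h
    exact ⟨⟨𝟙 b, hf⟩, Subtype.ext (Category.id_comp _), Subtype.ext (Category.id_comp _)⟩

variable {C : Type (u + 1)} [Category.{u} C] (J : GrothendieckTopology C)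

/-- The base category `C`, as a category over itself. -/
abbrev base (C : Type (u + 1)) [Category.{u} C] : BasedCategory.{u, u + 1} C :=
  BasedCategory.ofFunctor (𝟭 C)

/-- The structure morphism of a category over `C`, as a 1-morphism to `C`. -/
def toBase (𝒯 : BasedCategory.{u, u + 1} C) : 𝒯 ⥤ᵇ base C where
  toFunctor := 𝒯.p
  w := rfl

section
variable (𝒯 : BasedCategory.{u, u + 1} C) [IsFiberedInGroupoids 𝒯.p]

/-- The inherited topology on a category fibred in groupoids. -/
abbrev topology : GrothendieckTopology 𝒯.obj := inheritedTopology 𝒯.p J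

instance : 𝒯.p.IsContinuous (topology J 𝒯) J :=
  (liftsUniquely_of_isFiberedInGroupoids 𝒯.p).isContinuous fun _ => Iff.rfl

instance : 𝒯.p.IsCocontinuous (topology J 𝒯) J :=
  (liftsUniquely_of_isFiberedInGroupoids 𝒯.p).isCocontinuous fun _ => Iff.rfl

end

instance : IsFiberedInGroupoids (base C).p := inferInstanceAs (IsFiberedInGroupoids (𝟭 C))

variable {𝒴 𝒳 : BasedCategory.{u, u + 1} C} [IsFiberedInGroupoids 𝒴.p]
  [IsFiberedInGroupoids 𝒳.p]

instance (f : 𝒴 ⥤ᵇ 𝒳) : f.toFunctor.IsContinuous (topology J 𝒴) (topology J 𝒳) :=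
  (LiftsUniquely.of_comp f.w (liftsUniquely_of_isFiberedInGroupoids 𝒳.p)
    (liftsUniquely_of_isFiberedInGroupoids 𝒴.p)).isContinuous
      (mem_inheritedTopology_iff_of_comp f.w J)

instance (f : 𝒴 ⥤ᵇ 𝒳) : f.toFunctor.IsCocontinuous (topology J 𝒴) (topology J 𝒳) :=
  (LiftsUniquely.of_comp f.w (liftsUniquely_of_isFiberedInGroupoids 𝒳.p)
    (liftsUniquely_of_isFiberedInGroupoids 𝒴.p)).isCocontinuous
      (mem_inheritedTopology_iff_of_comp f.w J)

lemma sheafPushforwardContinuous_comp_eq (A : Type w) [Category.{v} A] (f : 𝒴 ⥤ᵇ 𝒳) :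
    𝒳.p.sheafPushforwardContinuous A (topology J 𝒳) J ⋙
        f.toFunctor.sheafPushforwardContinuous A (topology J 𝒴) (topology J 𝒳) =
      𝒴.p.sheafPushforwardContinuous A (topology J 𝒴) J := by
  have key (q : 𝒴.obj ⥤ C) (w : f.toFunctor ⋙ 𝒳.p = q) [q.IsContinuous (topology J 𝒴) J] :
      𝒳.p.sheafPushforwardContinuous A (topology J 𝒳) J ⋙
          f.toFunctor.sheafPushforwardContinuous A (topology J 𝒴) (topology J 𝒳) =
        q.sheafPushforwardContinuous A (topology J 𝒴) J := by
    subst w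
    rfl
  exact key 𝒴.p f.w

/-- The morphism of topoi `Sh(𝒯) ⟶ Sh(C)` induced by the structure morphism `𝒯 ⥤ C`. -/
noncomputable def structureMorphism (𝒯 : BasedCategory.{u, u + 1} C) [IsFiberedInGroupoids 𝒯.p] :
    GeomMorphism (Sheaf (topology J 𝒯) (Type (u + 1))) (Sheaf J (Type (u + 1))) :=
  .ofSites 𝒯.p (topology J 𝒯) J

/-- The morphism of topoi over `Sh(C)` induced by a 1-morphism `f : 𝒴 ⥤ 𝒳` of fibred categories. -/
noncomputable def inducedMorphism (f : 𝒴 ⥤ᵇ 𝒳) :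
    GeomMorphismOver (structureMorphism J 𝒴) (structureMorphism J 𝒳) where
  __ := GeomMorphism.ofSites f.toFunctor (topology J 𝒴) (topology J 𝒳)
  comm := sheafPushforwardContinuous_comp_eq J _ f

/-- The pull-back `G_𝒯` of an abelian sheaf `G` on `C`. -/
noncomputable abbrev pullbackAb (𝒯 : BasedCategory.{u, u + 1} C) [IsFiberedInGroupoids 𝒯.p]
    (G : Sheaf J AddCommGrpCat.{u + 1}) : Sheaf (topology J 𝒯) AddCommGrpCat.{u + 1} :=
  (𝒯.p.sheafPushforwardContinuous AddCommGrpCat.{u + 1} (topology J 𝒯) J).obj G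

/-- The pull-back `Hⁱ(𝒳, G_𝒳) → Hⁱ(𝒴, G_𝒴)` along `f : 𝒴 ⥤ 𝒳`, using `f^* G_𝒳 = G_𝒴`. -/
noncomputable def pullbackH (f : 𝒴 ⥤ᵇ 𝒳) (G : Sheaf J AddCommGrpCat.{u + 1}) (i : ℕ)
    (A : (pullbackAb J 𝒳 G).H i) : (pullbackAb J 𝒴 G).H i :=
  (sitePullbackH f.toFunctor (topology J 𝒴) (topology J 𝒳) (pullbackAb J 𝒳 G) i A).comp
    (Abelian.Ext.mk₀ (eqToHom
      (Functor.congr_obj (sheafPushforwardContinuous_comp_eq J AddCommGrpCat.{u + 1} f) G)))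
    (add_zero i)

variable (𝒜 𝒳 : BasedCategory.{u, u + 1} C) [IsFiberedInGroupoids 𝒜.p]
  [IsFiberedInGroupoids 𝒳.p]

/-- The derived obstruction: the full subcategory of `𝒳(𝒜)` of those `x` for which there are a
1-morphism `x₀ : Sh(C) ⟶ Sh(𝒳)` of topoi over `Sh(C)` and a 2-isomorphism `x ⟹ x₀ q` of
1-morphisms of topoi over `Sh(C)`, where `q` is the structure morphism of `𝒜`. -/
def derivedCategory : ObjectProperty (𝒜 ⥤ᵇ 𝒳) := fun x =>
  ∃ x₀ : GeomMorphismOver (structureMorphism J (base C)) (structureMorphism J 𝒳),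
    Nonempty (GeomMorphismOver.TwoIso (inducedMorphism J x)
      ((inducedMorphism J (toBase 𝒜)).comp x₀))

/-- The obstruction given by torsors under all sheaves of groups on `C`: the full subcategory of
`𝒳(𝒜)` of those `x` such that, for every sheaf of groups `G` on `C`, the pull-back along `x` of
every `G_𝒳`-torsor on `𝒳` is isomorphic to the pull-back along `q` of a `G`-torsor on `C`. -/
def torsorCategory : ObjectProperty (𝒜 ⥤ᵇ 𝒳) := fun x =>
  ∀ (G : Grp (Sheaf J (Type (u + 1)))) (A : H1 ((structureMorphism J 𝒳).pullbackGrp G)),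
    (inducedMorphism J x).pullbackH1 G A ∈
      Set.range ((inducedMorphism J (toBase 𝒜)).pullbackH1 G)

/-- The obstruction given by the `i`-th cohomology of all abelian sheaves on `C`: the full
subcategory of `𝒳(𝒜)` of those `x` such that, for every abelian sheaf `G` on `C`, the pull-back
along `x` of every class in `Hⁱ(𝒳, G_𝒳)` lies in the image of `q^* : Hⁱ(C, G) → Hⁱ(𝒜, G_𝒜)`. -/
def cohomologyCategory (i : ℕ) : ObjectProperty (𝒜 ⥤ᵇ 𝒳) := fun x =>
  ∀ (G : Sheaf J AddCommGrpCat.{u + 1}) (A : (pullbackAb J 𝒳 G).H i),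
    pullbackH J x G i A ∈ Set.range (pullbackH J (toBase 𝒜) G i)

end Fibred

section Schemes

/-- The two topologies under consideration: étale and fppf. -/
inductive Topo
  | etale
  | fppf

/-- The big étale or fppf topology on `Sch/S`. -/
def Topo.onSch (S : AlgebraicGeometry.Scheme.{u}) : Topo → GrothendieckTopology (Over S)
  | .etale => AlgebraicGeometry.Scheme.etaleTopology.over S
  | .fppf => AlgebraicGeometry.Scheme.fppfTopology.over S

variable (S : AlgebraicGeometry.Scheme.{u}) (𝒜 𝒳 : BasedCategory.{u, u + 1} (Over S))
  [IsFiberedInGroupoids 𝒜.p] [IsFiberedInGroupoids 𝒳.p]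

/-- The derived obstruction on `Sch/S` for the topology `τ`. -/
def derivedObstruction (τ : Topo) : ObjectProperty (BasedFunctor 𝒜 𝒳) :=
  derivedCategory (τ.onSch S) 𝒜 𝒳

/-- The generalized descent obstruction: torsors under all fppf sheaves of groups on `Sch/S`. -/
def descentObstruction : ObjectProperty (BasedFunctor 𝒜 𝒳) :=
  torsorCategory (Topo.fppf.onSch S) 𝒜 𝒳

/-- The `i`-th `τ`-descent obstruction: degree `i` `τ`-cohomology of all abelian `τ`-sheaves on
`Sch/S`. -/
def iDescentObstruction (i : ℕ) (τ : Topo) : ObjectProperty (BasedFunctor 𝒜 𝒳) :=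
  cohomologyCategory (τ.onSch S) 𝒜 𝒳 i

end Schemes

end DerivedObstruction

universe w₁ w₂ w₃

open Opposite

namespace DerivedObstruction

/-! ### Torsors under composition and 2-isomorphism of morphisms of topoi -/

section

variable {B : Type u₁} [Category.{v₁} B] [CartesianMonoidalCategory B]
  {E E' E'' : Type u₂} [Category.{v₂} E] [CartesianMonoidalCategory E]
  [Category.{v₂} E'] [CartesianMonoidalCategory E'] [Category.{v₂} E'']
  [CartesianMonoidalCategory E'']

/-! Both inclusions hold over any site, and both come from one factorization: `ξ` identifies `x^*`
with `q^* x₀^*`, so a class on `𝒳` pulls back to `𝒜` as the `q`-pull-back of its image under `x₀^*`,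
which is a class on the base. The work lies in giving `x₀^*` an effect on torsors and on cohomology,
and in checking that coefficients match. For the latter, the strict equality `x₀^* p^* = id` and the
condition that `ξ` is the identity on objects pulled back from the base are essential.

For torsors, `x₀^*` preserves finite products and epimorphisms, hence torsors. The components of `ξ`
are equivariant because every natural transformation between product-preserving functors respects
products, and because `ξ` is the identity on the group (`TwoIso.pullbackH1_eq`, `pullbackH1_comp`).

For cohomology, `x₀^*` is given only on sheaves of sets. A left exact functor from an additive
category to sets lifts to abelian groups, so `x₀^*` induces a functor on abelian sheaves
(`abelianize`), exact because it also preserves epimorphisms. Natural transformations lift as well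
(`natTransLift`), since addition is itself induced by morphisms of the source category. Cohomology
is `Ext` out of the constant sheaf `ℤ`; dimension shifting shows that `Ext` is natural in the exact
functor (`mapExactFunctor_natTrans`), and `exists_ext_of_natTrans` then produces the required class
on the base. -/

/-- Any natural transformation between product-preserving functors is monoidal: the two sides agree
after each projection. -/
lemma map_μ_natTrans {F : Type u₃} [Category.{v₃} F] [CartesianMonoidalCategory F] {Φ Ψ : E ⥤ F}
    [Φ.Monoidal] [Ψ.Monoidal] (α : Φ ⟶ Ψ) (X Y : E) :
    Functor.LaxMonoidal.μ Φ X Y ≫ α.app (X ⊗ Y) =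
      (α.app X ⊗ₘ α.app Y) ≫ Functor.LaxMonoidal.μ Ψ X Y := by
  rw [← cancel_mono (Functor.Monoidal.μIso Ψ X Y).inv]
  ext <;> simp

/-- The monoidal structure on an inverse image is chosen separately for each functor, so the one on
a composite is not the composite structure by definition. The projections force the two to agree. -/
lemma μ_comp_of_cartesian {F : Type u₃} [Category.{v₃} F] [CartesianMonoidalCategory F]
    (Φ : E ⥤ E') (Ψ : E' ⥤ F) [Φ.Monoidal] [Ψ.Monoidal] [h : (Φ ⋙ Ψ).Monoidal] (X Y : E) :
    h.toLaxMonoidal.μ X Y =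
      Functor.LaxMonoidal.μ Ψ (Φ.obj X) (Φ.obj Y) ≫ Ψ.map (Functor.LaxMonoidal.μ Φ X Y) := by
  rw [← cancel_mono (h.toOplaxMonoidal.δ X Y)]
  have h₁ : h.toLaxMonoidal.μ X Y ≫ h.toOplaxMonoidal.δ X Y = 𝟙 _ := h.μ_δ X Y
  rw [h₁]
  have h₂ : h.toOplaxMonoidal.δ X Y ≫ fst _ _ = Ψ.map (Φ.map (fst X Y)) :=
    @Functor.OplaxMonoidal.δ_fst _ _ _ _ _ _ (Φ ⋙ Ψ) h.toOplaxMonoidal X Y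
  have h₃ : h.toOplaxMonoidal.δ X Y ≫ snd _ _ = Ψ.map (Φ.map (snd X Y)) :=
    @Functor.OplaxMonoidal.δ_snd _ _ _ _ _ _ (Φ ⋙ Ψ) h.toOplaxMonoidal X Y
  apply CartesianMonoidalCategory.hom_ext
  · rw [Category.assoc, Category.assoc, h₂, ← Ψ.map_comp, Functor.Monoidal.μ_fst,
      Functor.Monoidal.μ_fst]
    simp
  · rw [Category.assoc, Category.assoc, h₃, ← Ψ.map_comp, Functor.Monoidal.μ_snd,
      Functor.Monoidal.μ_snd]
    simp

/-- This is the equivariance of `α.app X` when both actions are restricted to a common object `T`;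
`a` and `b` will be the identifications of the pulled-back groups. -/
lemma map_act_natTrans {F : Type u₃} [Category.{v₃} F] [CartesianMonoidalCategory F]
    {Φ Ψ : E ⥤ F} [Φ.Monoidal] [Ψ.Monoidal] (α : Φ ⟶ Ψ) {X G : E} (act : X ⊗ G ⟶ X) {T : F}
    (a : T ⟶ Φ.obj G) (b : T ⟶ Ψ.obj G) (h : a ≫ α.app G = b) :
    (Φ.obj X ◁ a ≫ Functor.LaxMonoidal.μ Φ X G ≫ Φ.map act) ≫ α.app X =
      α.app X ▷ T ≫ Ψ.obj X ◁ b ≫ Functor.LaxMonoidal.μ Ψ X G ≫ Ψ.map act := by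
  subst h
  have h₁ := map_μ_natTrans α X G
  rw [Category.assoc, Category.assoc, α.naturality, reassoc_of% h₁, tensorHom_def',
    MonoidalCategory.whiskerLeft_comp, Category.assoc, Category.assoc, whisker_exchange_assoc,
    whisker_exchange_assoc]

lemma map_act_comp {F : Type u₃} [Category.{v₃} F] [CartesianMonoidalCategory F]
    (Φ : E ⥤ E') (Ψ : E' ⥤ F) [Φ.Monoidal] [Ψ.Monoidal] [h : (Φ ⋙ Ψ).Monoidal] {X G : E}
    (act : X ⊗ G ⟶ X) {S : E'} {T : F} (a : T ⟶ Ψ.obj S) (b : S ⟶ Φ.obj G)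
    (c : T ⟶ Ψ.obj (Φ.obj G)) (hc : a ≫ Ψ.map b = c) :
    Ψ.obj (Φ.obj X) ◁ c ≫ h.toLaxMonoidal.μ X G ≫ Ψ.map (Φ.map act) =
      Ψ.obj (Φ.obj X) ◁ a ≫ Functor.LaxMonoidal.μ Ψ (Φ.obj X) S ≫
        Ψ.map (Φ.obj X ◁ b ≫ Functor.LaxMonoidal.μ Φ X G ≫ Φ.map act) := by
  subst hc
  rw [μ_comp_of_cartesian]
  simp

variable {x : GeomMorphism E B} {y : GeomMorphism E' B} {z : GeomMorphism E'' B}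

/-- It puts the identification of groups in the same `eqToHom` form as `TwoIso.compat`, so that the
two can be composed. -/
lemma GeomMorphismOver.pullbackGrpIso_inv (f : GeomMorphismOver x y) (G : Grp B) :
    (f.pullbackGrpIso G).inv.hom.hom = eqToHom (Functor.congr_obj f.comm G.X).symm := by
  simp only [pullbackGrpIso, Iso.app_inv, Iso.trans_inv, Iso.symm_inv, NatTrans.comp_app,
    Functor.mapGrpNatIso_inv_app_hom_hom, Functor.mapGrpCompIso_hom_app_hom_hom,
    eqToIso.inv, eqToHom_app, Grp.comp_hom_hom]
  exact Category.comp_id _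

lemma GeomMorphismOver.TwoIso.pullbackH1_eq {f g : GeomMorphismOver x y} (ξ : TwoIso f g)
    (G : Grp B) (A : H1 (y.pullbackGrp G)) : f.pullbackH1 G A = g.pullbackH1 G A := by
  induction A using Quotient.inductionOn with | _ P
  -- `ξ.iso` goes from `g.inverse` to `f.inverse`, hence the symmetry.
  refine (Quotient.sound (Nonempty.intro (Torsor.Iso.mk (ξ.iso.app P.X) ?_))).symm
  refine map_act_natTrans ξ.iso.hom (X := P.X) (G := y.inverse.obj G.X) P.act _ _ ?_
  rw [pullbackGrpIso_inv, pullbackGrpIso_inv, ξ.compat G.X]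
  exact eqToHom_trans _ _

lemma GeomMorphismOver.pullbackH1_comp (f : GeomMorphismOver x y) (g : GeomMorphismOver y z)
    (G : Grp B) (A : H1 (z.pullbackGrp G)) :
    (f.comp g).pullbackH1 G A = f.pullbackH1 G (g.pullbackH1 G A) := by
  induction A using Quotient.inductionOn with | _ P
  -- The underlying objects coincide by definition; only the actions have to be compared.
  refine Quotient.sound (Nonempty.intro (Torsor.Iso.mk (Iso.refl _) ?_))
  have id_whisker {X Y Z : E} (f : X ⊗ Y ⟶ Z) : f = 𝟙 X ▷ Y ≫ f := by simp
  refine (Category.comp_id _).trans (Eq.trans ?_ (id_whisker _))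
  refine map_act_comp g.inverse f.inverse (h := (inferInstance : (f.comp g).inverse.Monoidal))
    (X := P.X) (G := z.inverse.obj G.X) P.act _ _ _ ?_
  rw [pullbackGrpIso_inv, pullbackGrpIso_inv, pullbackGrpIso_inv]
  exact (congrArg _ (eqToHom_map _ _)).trans (eqToHom_trans _ _)

end

lemma derivedCategory_le_torsorCategory {C : Type (u + 1)} [Category.{u} C]
    (J : GrothendieckTopology C) (𝒜 𝒳 : BasedCategory.{u, u + 1} C) [IsFiberedInGroupoids 𝒜.p]
    [IsFiberedInGroupoids 𝒳.p] : derivedCategory J 𝒜 𝒳 ≤ torsorCategory J 𝒜 𝒳 := by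
  rintro x ⟨x₀, ⟨ξ⟩⟩ G A
  exact ⟨x₀.pullbackH1 G A, by rw [ξ.pullbackH1_eq, GeomMorphismOver.pullbackH1_comp]⟩

/-! ### Naturality of `Ext` in exact functors -/

section

variable {A : Type u₁} [Category.{v₁} A] [Abelian A] [HasExt.{w₁} A] [EnoughInjectives A]
  {B : Type u₂} [Category.{v₂} B] [Abelian B] [HasExt.{w₂} B]
  {C : Type u₃} [Category.{v₃} C] [Abelian C] [HasExt.{w₃} C]

open Abelian in
/-- A class of positive degree factors through the extension class of an embedding of its target
into an injective object. -/
lemma exists_comp_extClass {X Y : A} {n : ℕ} (e : Ext X Y (n + 1)) :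
    ∃ (S : ShortComplex A) (hS : S.ShortExact) (hY : Y = S.X₁) (e' : Ext X S.X₃ n),
      (e'.comp hS.extClass rfl).comp (Ext.mk₀ (eqToHom hY.symm)) (add_zero _) = e := by
  -- Dimension shifting: the image of `e` in the positive-degree `Ext` into the injective object
  -- vanishes, so `e` comes from the cokernel.
  let I : InjectivePresentation Y := Classical.arbitrary _
  let S := ShortComplex.mk _ _ (cokernel.condition I.f)
  have hS : S.ShortExact := { exact := ShortComplex.exact_cokernel I.f }
  obtain ⟨e', he'⟩ := Ext.covariant_sequence_exact₁ X hS e (Ext.eq_zero_of_injective _) rfl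
  exact ⟨S, hS, rfl, e', by simpa using he'⟩

open Abelian in
/-- The maps on `Ext` induced by exact functors are natural with respect to a natural
transformation between a composition and an exact functor. -/
lemma mapExactFunctor_natTrans (F : A ⥤ B) (G : B ⥤ C) (H : A ⥤ C) [F.Additive] [G.Additive]
    [H.Additive] [PreservesFiniteLimits F] [PreservesFiniteLimits G] [PreservesFiniteLimits H]
    [PreservesFiniteColimits F] [PreservesFiniteColimits G] [PreservesFiniteColimits H]
    (α : F ⋙ G ⟶ H) {X Y : A} {n : ℕ} (e : Ext X Y n) :
    ((e.mapExactFunctor F).mapExactFunctor G).comp (Ext.mk₀ (α.app Y)) (add_zero n) =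
      (Ext.mk₀ (α.app X)).comp (e.mapExactFunctor H) (zero_add n) := by
  induction n generalizing Y with
  | zero =>
    obtain ⟨f, rfl⟩ := (Ext.mk₀_bijective X Y).2 e
    simp only [Ext.mapExactFunctor_mk₀, Ext.mk₀_comp_mk₀]
    exact congrArg _ (α.naturality f)
  | succ n ih =>
    obtain ⟨S, hS, rfl, e', rfl⟩ := exists_comp_extClass e
    have hFG : (hS.extClass.mapExactFunctor F).mapExactFunctor G =
        ((hS.map_of_exact F).map_of_exact G).extClass :=
      (congrArg (Ext.mapExactFunctor G) (Ext.mapExactFunctor_extClass F hS)).trans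
        (Ext.mapExactFunctor_extClass G _)
    -- The degree 1 case for extension classes: `α` gives a morphism between the two image short
    -- exact sequences of `S`.
    have h : ((hS.extClass.mapExactFunctor F).mapExactFunctor G).comp
        (Ext.mk₀ (α.app S.X₁)) (add_zero 1) =
          (Ext.mk₀ (α.app S.X₃)).comp (hS.extClass.mapExactFunctor H) (zero_add 1) :=
      (congrArg (fun t => Ext.comp t _ _) hFG).trans
        ((ShortComplex.ShortExact.extClass_naturality ((hS.map_of_exact F).map_of_exact G)
          (hS.map_of_exact H) (S.mapNatTrans α)).trans
          (congrArg (fun t => Ext.comp _ t _) (Ext.mapExactFunctor_extClass H hS).symm))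
    simp only [eqToHom_refl, Ext.comp_mk₀_id, Ext.mapExactFunctor_comp]
    -- `α` moves past the extension class by `h`, then past `e'` by the induction hypothesis at
    -- `S.X₃`.
    rw [Ext.comp_assoc_of_third_deg_zero, h, ← Ext.comp_assoc_of_second_deg_zero, ih e',
      Ext.comp_assoc _ _ _ (zero_add n) rfl (by simp)]

end

/-! ### Lifting left exact functors and their transformations from sets to abelian groups -/

section

variable {A : Type u₁} [Category.{u + 1} A] [Preadditive A] [HasFiniteBiproducts A]
  {C : Type (u + 1)} [Category.{u} C] {J : GrothendieckTopology C}

section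

variable (Ψ : A ⥤ Sheaf J (Type (u + 1))) [PreservesFiniteLimits Ψ]

/-- The sections of the values of a left exact functor to sheaves, as left exact functors. -/
def sectionsLeftExact : Cᵒᵖ ⥤ (A ⥤ₗ Type (u + 1)) :=
  ObjectProperty.lift _ (sheafSections J (Type (u + 1)) ⋙ (Functor.whiskeringLeft _ _ _).obj Ψ)
    (fun U => by
      rw [leftExactFunctor_iff]
      have : PreservesFiniteLimits ((sheafSections J (Type (u + 1))).obj U) :=
        inferInstanceAs (PreservesFiniteLimits
          (sheafToPresheaf J (Type (u + 1)) ⋙ (evaluation _ _).obj U))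
      exact comp_preservesFiniteLimits Ψ ((sheafSections J (Type (u + 1))).obj U))

/-- The lift of a left exact functor from an additive category to sheaves of sets, to sheaves of
abelian groups. -/
noncomputable def liftAb : A ⥤ Sheaf J AddCommGrpCat.{u + 1} :=
  ObjectProperty.lift _
    (sectionsLeftExact Ψ ⋙ (AddCommGrpCat.leftExactFunctorForgetEquivalence A).inverse ⋙
      ObjectProperty.ι _).flip
    -- The sheaf condition only concerns underlying sets, and these are by definition the sections
    -- of `Ψ.obj M`.
    (fun M => (Presheaf.isSheaf_iff_isSheaf_forget J _ (forget AddCommGrpCat.{u + 1})).2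
      (Ψ.obj M).property)

/-- The underlying sheaves of sets of the values of `liftAb Ψ` are those of `Ψ`. -/
noncomputable def liftAbForget :
    liftAb Ψ ⋙ sheafCompose J (forget AddCommGrpCat.{u + 1}) ≅ Ψ :=
  NatIso.ofComponents (fun M => Iso.refl _)

instance : PreservesFiniteLimits (liftAb Ψ) where
  preservesFiniteLimits I _ _ := by
    have : PreservesLimitsOfShape I (liftAb Ψ ⋙ sheafToPresheaf J AddCommGrpCat.{u + 1}) := by
      refine preservesLimitsOfShape_of_evaluation _ _ fun U => ?_
      have := ((leftExactFunctor_iff _).1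
        ((AddCommGrpCat.leftExactFunctorForgetEquivalence A).inverse.obj
          ((sectionsLeftExact Ψ).obj U)).property)
      exact inferInstanceAs (PreservesLimitsOfShape I
        ((AddCommGrpCat.leftExactFunctorForgetEquivalence A).inverse.obj
          ((sectionsLeftExact Ψ).obj U)).obj)
    exact preservesLimitsOfShape_of_reflects_of_preserves _
      (sheafToPresheaf J AddCommGrpCat.{u + 1})

instance : (liftAb Ψ).Additive :=
  Functor.additive_of_preserves_binary_products _

/-- Epimorphisms of sheaves are the locally surjective maps, a condition on underlying sets alone.
-/
instance [Ψ.PreservesEpimorphisms] : (liftAb Ψ).PreservesEpimorphisms where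
  preserves {M N} f _ := by
    have h : Sheaf.IsLocallySurjective (Ψ.map f) :=
      (Sheaf.isLocallySurjective_iff_epi _).2 inferInstance
    have : Sheaf.IsLocallySurjective ((liftAb Ψ).map f) :=
      (Presheaf.isLocallySurjective_iff_whisker_forget J _).2 h
    infer_instance

end

instance : (sheafCompose J (forget AddCommGrpCat.{u + 1})).PreservesEpimorphisms where
  preserves {M N} f _ := by
    have h : Sheaf.IsLocallySurjective f :=
      (Sheaf.isLocallySurjective_iff_epi' _ _).2 inferInstance
    have : Sheaf.IsLocallySurjective ((sheafCompose J (forget AddCommGrpCat.{u + 1})).map f) :=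
      (Presheaf.isLocallySurjective_iff_whisker_forget J _).1 h
    infer_instance

instance : PreservesFiniteLimits (sheafCompose J (forget AddCommGrpCat.{u + 1})) where
  preservesFiniteLimits I _ _ := by
    have : PreservesLimitsOfShape I (sheafCompose J (forget AddCommGrpCat.{u + 1}) ⋙
        sheafToPresheaf J (Type (u + 1))) :=
      inferInstanceAs (PreservesLimitsOfShape I (sheafToPresheaf J AddCommGrpCat.{u + 1} ⋙
        (Functor.whiskeringRight _ _ _).obj (forget AddCommGrpCat.{u + 1})))
    exact preservesLimitsOfShape_of_reflects_of_preserves _ (sheafToPresheaf J (Type (u + 1)))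

section

variable {Φ₁ Φ₂ : A ⥤ Sheaf J AddCommGrpCat.{u + 1}} [Φ₁.Additive] [Φ₂.Additive]
  (α : Φ₁ ⋙ sheafCompose J (forget AddCommGrpCat.{u + 1}) ⟶
    Φ₂ ⋙ sheafCompose J (forget AddCommGrpCat.{u + 1}))

/-- The map on sections given by a natural transformation between the underlying sheaves of
sets. -/
def sectionsMap (M : A) (U : Cᵒᵖ) (s : (Φ₁.obj M).obj.obj U) : (Φ₂.obj M).obj.obj U :=
  (α.app M).hom.app U s

omit [Preadditive A] [HasFiniteBiproducts A] [Φ₁.Additive] [Φ₂.Additive] in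
lemma sectionsMap_map {M N : A} (f : M ⟶ N) (U : Cᵒᵖ) (s : (Φ₁.obj M).obj.obj U) :
    sectionsMap α N U ((Φ₁.map f).hom.app U s) = (Φ₂.map f).hom.app U (sectionsMap α M U s) := by
  have h := congrArg (fun h => h.hom.app U) (α.naturality f)
  exact ConcreteCategory.congr_hom h s

omit [Preadditive A] [HasFiniteBiproducts A] [Φ₁.Additive] [Φ₂.Additive] in
lemma sectionsMap_restrict (M : A) {U V : Cᵒᵖ} (g : U ⟶ V) (s : (Φ₁.obj M).obj.obj U) :
    sectionsMap α M V ((Φ₁.obj M).obj.map g s) = (Φ₂.obj M).obj.map g (sectionsMap α M U s) :=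
  ConcreteCategory.congr_hom ((α.app M).hom.naturality g) s

/-- A natural transformation between the underlying sheaves of sets of additive functors is
compatible with the addition. -/
lemma sectionsMap_add (M : A) (U : Cᵒᵖ) (s t : (Φ₁.obj M).obj.obj U) :
    sectionsMap α M U (s + t) = sectionsMap α M U s + sectionsMap α M U t := by
  have map_add {Φ : A ⥤ Sheaf J AddCommGrpCat.{u + 1}} [Φ.Additive] {N N' : A} (f g : N ⟶ N')
      (r : (Φ.obj N).obj.obj U) :
      (Φ.map (f + g)).hom.app U r = (Φ.map f).hom.app U r + (Φ.map g).hom.app U r := by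
    rw [Φ.map_add]
    rfl
  have comp {N N' N'' : A} (f : N ⟶ N') (g : N' ⟶ N'') (r : (Φ₁.obj N).obj.obj U) :
      (Φ₁.map g).hom.app U ((Φ₁.map f).hom.app U r) = (Φ₁.map (f ≫ g)).hom.app U r := by
    rw [Φ₁.map_comp]
    rfl
  have id (r : (Φ₁.obj M).obj.obj U) : (Φ₁.map (𝟙 M)).hom.app U r = r := by
    rw [Φ₁.map_id]
    rfl
  have zero (r : (Φ₁.obj M).obj.obj U) : (Φ₁.map (0 : M ⟶ M)).hom.app U r = 0 := by
    rw [Φ₁.map_zero]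
    rfl
  have := hasBinaryBiproducts_of_finite_biproducts A
  -- The section corresponding to the pair `(s, t)`. Both `s` and `t` are images of `r`, and their
  -- sum is its image under `biprod.fst + biprod.snd`, so naturality for these three morphisms gives
  -- additivity.
  let r : (Φ₁.obj (M ⊞ M)).obj.obj U :=
    (Φ₁.map biprod.inl).hom.app U s + (Φ₁.map biprod.inr).hom.app U t
  have h₁ : (Φ₁.map biprod.fst).hom.app U r = s := by
    simp only [r, _root_.map_add, comp, biprod.inl_fst, biprod.inr_fst, id, zero, add_zero]
  have h₂ : (Φ₁.map biprod.snd).hom.app U r = t := by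
    simp only [r, _root_.map_add, comp, biprod.inl_snd, biprod.inr_snd, id, zero, zero_add]
  rw [← h₁, ← h₂, ← map_add, sectionsMap_map, sectionsMap_map, sectionsMap_map, map_add]

/-- A natural transformation between the underlying sheaves of sets of additive functors, as a
natural transformation of functors to sheaves of abelian groups. -/
noncomputable def natTransLift : Φ₁ ⟶ Φ₂ where
  app M := ⟨{
    app U := AddCommGrpCat.ofHom (AddMonoidHom.mk' (sectionsMap α M U) (sectionsMap_add α M U))
    naturality U V g := by
      ext s
      exact sectionsMap_restrict α M g s }⟩
  naturality M N f := by
    ext U s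
    exact sectionsMap_map α f U s

end

end

/-! ### Descending an `Ext` class along a natural transformation -/

section

open Abelian

/-- If the functor `X` receives a natural transformation from the composition of exact functors
`Φ` and `Q`, then the image under `X` of a class in `Ext` is in the image of `Q`, up to given
morphisms compatible with the natural transformation. -/
lemma exists_ext_of_natTrans {A : Type u₁} [Category.{v₁} A] [Abelian A] [HasExt.{w₁} A]
    [EnoughInjectives A] {B : Type u₂} [Category.{v₂} B] [Abelian B] [HasExt.{w₂} B]
    {C : Type u₃} [Category.{v₃} C] [Abelian C] [HasExt.{w₃} C]
    (Φ : A ⥤ B) (Q : B ⥤ C) (X : A ⥤ C) [Φ.Additive] [Q.Additive] [X.Additive]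
    [PreservesFiniteLimits Φ] [PreservesFiniteLimits Q] [PreservesFiniteLimits X]
    [PreservesFiniteColimits Φ] [PreservesFiniteColimits Q] [PreservesFiniteColimits X]
    (α : Φ ⋙ Q ⟶ X) {Z₁ G₁ : A} {Z₂ G₂ : B} {Z₃ G₃ : C} {cX : Z₃ ⟶ X.obj Z₁}
    {cQ : Z₃ ⟶ Q.obj Z₂} {d : X.obj G₁ ⟶ G₃} {d' : Q.obj G₂ ⟶ G₃} (e : Z₂ ⟶ Φ.obj Z₁)
    (δ : Φ.obj G₁ ⟶ G₂) (h₁ : cQ ≫ Q.map e ≫ α.app Z₁ = cX)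
    (h₂ : Q.map δ ≫ d' = α.app G₁ ≫ d) {i : ℕ} (a : Ext Z₁ G₁ i) :
    ∃ b : Ext Z₂ G₂ i,
      ((Ext.mk₀ cQ).comp (b.mapExactFunctor Q) (zero_add i)).comp (Ext.mk₀ d') (add_zero i) =
        ((Ext.mk₀ cX).comp (a.mapExactFunctor X) (zero_add i)).comp (Ext.mk₀ d) (add_zero i) := by
  -- The image of `a` under `Φ`, with source and target corrected by `e` and `δ`.
  refine ⟨((Ext.mk₀ e).comp (a.mapExactFunctor Φ) (zero_add i)).comp (Ext.mk₀ δ) (add_zero i), ?_⟩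
  subst h₁
  have h := mapExactFunctor_natTrans Φ Q X α a
  simp only [Ext.mapExactFunctor_comp, Ext.mapExactFunctor_mk₀, Ext.comp_assoc_of_third_deg_zero,
    Ext.mk₀_comp_mk₀, h₂]
  rw [← Ext.mk₀_comp_mk₀, ← Ext.comp_assoc_of_third_deg_zero _ _ (Ext.mk₀ d), h]
  simp only [← Ext.comp_assoc_of_second_deg_zero, Ext.mk₀_comp_mk₀,
    Ext.comp_assoc_of_third_deg_zero]

end

/-! ### Constant sheaves under composition of pull-backs -/

section

variable {C D E : Type (u + 1)} [Category.{u} C] [Category.{u} D] [Category.{u} E]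

/-- `H` is kept as a variable because based functors satisfy `f ⋙ p = q` only as a proposition; once
it is eliminated the equality is definitional. -/
lemma sheafPushforwardContinuous_comp {F : C ⥤ D} {G : D ⥤ E} {H : C ⥤ E} (w : F ⋙ G = H)
    (J : GrothendieckTopology C) (K : GrothendieckTopology D) (L : GrothendieckTopology E)
    [F.IsContinuous J K] [G.IsContinuous K L] [H.IsContinuous J L]
    (A : Type u₁) [Category.{v₁} A] :
    G.sheafPushforwardContinuous A K L ⋙ F.sheafPushforwardContinuous A J K =
      H.sheafPushforwardContinuous A J L := by
  subst w
  rfl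

/-- A map from a sheafification to a sheaf is determined by its composite with the unit, and both
sides send the unit to the pulled-back unit. -/
lemma constantSheafPullbackIso_comp {F : C ⥤ D} {G : D ⥤ E} {H : C ⥤ E} (w : F ⋙ G = H)
    (J : GrothendieckTopology C) (K : GrothendieckTopology D) (L : GrothendieckTopology E)
    [F.IsContinuous J K] [G.IsContinuous K L] [H.IsContinuous J L]
    [F.IsCocontinuous J K] [G.IsCocontinuous K L] [H.IsCocontinuous J L]
    (M : AddCommGrpCat.{u + 1}) :
    (constantSheafPullbackIso F J K M).hom ≫
        (F.sheafPushforwardContinuous AddCommGrpCat.{u + 1} J K).map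
          (constantSheafPullbackIso G K L M).hom ≫
        eqToHom (Functor.congr_obj (sheafPushforwardContinuous_comp w J K L _) _) =
      (constantSheafPullbackIso H J L M).hom := by
  subst w
  have key {C D : Type (u + 1)} [Category.{u} C] [Category.{u} D] (F : C ⥤ D)
      (J : GrothendieckTopology C) (K : GrothendieckTopology D) [F.IsContinuous J K]
      [F.IsCocontinuous J K] : toSheafify J ((Functor.const _).obj M) ≫
        (constantSheafPullbackIso F J K M).hom.hom =
          Functor.whiskerLeft F.op (toSheafify K ((Functor.const _).obj M)) :=
    F.toSheafify_pullbackSheafificationCompatibility AddCommGrpCat.{u + 1} J K _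
  apply Sheaf.hom_ext
  refine sheafify_hom_ext J _ _ (ObjectProperty.FullSubcategory.property _) ?_
  refine Eq.trans ?_ (key (F ⋙ G) J L).symm
  have h₁ := key F J K
  have h₂ := congrArg (Functor.whiskerLeft F.op) (key G K L)
  refine Eq.trans (congrArg (fun t => toSheafify J ((Functor.const _).obj M) ≫
    ((constantSheafPullbackIso F J K M).hom ≫ t).hom) (Category.comp_id _)) ?_
  refine (Category.assoc (obj := Cᵒᵖ ⥤ AddCommGrpCat.{u + 1}) _ _ _).symm.trans ?_
  exact (congrArg (fun t => t ≫ _) h₁).trans h₂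

end

/-! ### The exact functor on abelian sheaves induced by `x₀^*`, and its comparison maps -/

section

variable {C : Type (u + 1)} [Category.{u} C] {J : GrothendieckTopology C}
  {𝒜 𝒳 : BasedCategory.{u, u + 1} C} [IsFiberedInGroupoids 𝒜.p] [IsFiberedInGroupoids 𝒳.p]

instance : EnoughInjectives (Sheaf J AddCommGrpCat.{u + 1}) :=
  have : EssentiallySmall.{u + 1} C := by infer_instance
  have : IsGrothendieckAbelian.{u + 1} (Sheaf J AddCommGrpCat.{u + 1}) :=
    Sheaf.isGrothendieckAbelian_of_essentiallySmall J AddCommGrpCat.{u + 1}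
  inferInstance

instance : HasFiniteBiproducts (Sheaf J AddCommGrpCat.{u + 1}) :=
  Abelian.hasFiniteBiproducts

variable (J) in
/-- The sheaf of sets underlying an abelian sheaf. -/
abbrev underlying : Sheaf J AddCommGrpCat.{u + 1} ⥤ Sheaf J (Type (u + 1)) :=
  sheafCompose J (forget AddCommGrpCat.{u + 1})

section

variable {D : Type (u + 1)} [Category.{u} D] {K : GrothendieckTopology D}
  (Ψ : Sheaf K (Type (u + 1)) ⥤ Sheaf J (Type (u + 1))) [PreservesFiniteLimits Ψ]

/-- The functor induced on abelian sheaves by a left exact functor on sheaves of sets. -/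
noncomputable def abelianize : Sheaf K AddCommGrpCat.{u + 1} ⥤ Sheaf J AddCommGrpCat.{u + 1} :=
  liftAb (underlying K ⋙ Ψ)

instance : (abelianize Ψ).Additive := inferInstanceAs (liftAb _).Additive

instance : PreservesFiniteLimits (abelianize Ψ) :=
  inferInstanceAs (PreservesFiniteLimits (liftAb _))

instance [Ψ.PreservesEpimorphisms] : (abelianize Ψ).PreservesEpimorphisms :=
  inferInstanceAs (liftAb _).PreservesEpimorphisms

/-- Left exactness handles kernels, and preservation of epimorphisms the right end of a short exact
sequence. -/
instance [Ψ.PreservesEpimorphisms] : PreservesFiniteColimits (abelianize Ψ) := by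
  refine (Functor.preservesFiniteColimits_iff_forall_exact_map_and_epi _).2 fun S hS => ?_
  have := hS.epi_g
  exact ⟨hS.exact.map_of_mono_of_preservesKernel _ hS.mono_f inferInstance, inferInstance⟩

/-- The sheaf of sets underlying `abelianize Ψ M` is the image by `Ψ` of the one underlying `M`. -/
noncomputable def abelianizeForget : abelianize Ψ ⋙ underlying J ≅ underlying K ⋙ Ψ :=
  liftAbForget _

end

variable (x₀ : GeomMorphismOver (structureMorphism J (base C)) (structureMorphism J 𝒳))

/-- The pull-back of abelian sheaves from `C`. -/
noncomputable abbrev pullbackFunctor (J : GrothendieckTopology C) (𝒯 : BasedCategory.{u, u + 1} C)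
    [IsFiberedInGroupoids 𝒯.p] :
    Sheaf J AddCommGrpCat.{u + 1} ⥤ Sheaf (topology J 𝒯) AddCommGrpCat.{u + 1} :=
  𝒯.p.sheafPushforwardContinuous AddCommGrpCat.{u + 1} (topology J 𝒯) J

/-- The pull-back of abelian sheaves along a 1-morphism. -/
noncomputable abbrev pullbackAlong (J : GrothendieckTopology C) (f : 𝒜 ⥤ᵇ 𝒳) :
    Sheaf (topology J 𝒳) AddCommGrpCat.{u + 1} ⥤ Sheaf (topology J 𝒜) AddCommGrpCat.{u + 1} :=
  f.toFunctor.sheafPushforwardContinuous AddCommGrpCat.{u + 1} (topology J 𝒜) (topology J 𝒳)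

instance (f : 𝒜 ⥤ᵇ 𝒳) : PreservesFiniteColimits (pullbackAlong J f) :=
  preservesFiniteColimits_sheafPushforwardContinuous _ _ _

/-- The comparison of the pull-back to `𝒳` followed by `x₀^*` with the pull-back to `C`. -/
noncomputable def abelianizeComm :
    pullbackFunctor J 𝒳 ⋙ abelianize x₀.inverse ⟶ pullbackFunctor J (base C) :=
  natTransLift (Functor.whiskerLeft (pullbackFunctor J 𝒳) (abelianizeForget x₀.inverse).hom ≫
    Functor.whiskerLeft (underlying J) (eqToHom x₀.comm))

/-- The inverse of `abelianizeComm`. -/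
noncomputable def abelianizeCommInv :
    pullbackFunctor J (base C) ⟶ pullbackFunctor J 𝒳 ⋙ abelianize x₀.inverse :=
  natTransLift (Functor.whiskerLeft (underlying J) (eqToHom x₀.comm.symm) ≫
    Functor.whiskerLeft (pullbackFunctor J 𝒳) (abelianizeForget x₀.inverse).inv)

variable {x : 𝒜 ⥤ᵇ 𝒳} {x₀} (ξ : GeomMorphismOver.TwoIso (inducedMorphism J x)
      ((inducedMorphism J (toBase 𝒜)).comp x₀))

/-- The comparison of `x₀^*` followed by the pull-back to `𝒜` with `x^*` on abelian sheaves. -/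
noncomputable def abelianizeTwoIso :
    abelianize x₀.inverse ⋙ pullbackAlong J (toBase 𝒜) ⟶ pullbackAlong J x :=
  natTransLift (Functor.whiskerRight (abelianizeForget x₀.inverse).hom
    (inducedMorphism J (toBase 𝒜)).inverse ≫
      Functor.whiskerLeft (underlying (topology J 𝒳)) ξ.iso.hom)

lemma pullbackAlong_obj (f : 𝒜 ⥤ᵇ 𝒳) (G : Sheaf J AddCommGrpCat.{u + 1}) :
    (pullbackAlong J f).obj ((pullbackFunctor J 𝒳).obj G) = (pullbackFunctor J 𝒜).obj G :=
  Functor.congr_obj (sheafPushforwardContinuous_comp_eq J AddCommGrpCat.{u + 1} f) G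

/-- The objects are free variables so that the equalities can be eliminated; the same holds for
`map_eqToHom_comp_inv`. -/
lemma map_comp_eqToHom {E : Type u₁} [Category.{v₁} E] {F : Type u₂} [Category.{v₂} F] (Q : E ⥤ F)
    {X Y Z : E} {V W : F} (a : X ⟶ Y) (h : Y = Z) (h₁ : Q.obj Z = W) (h₂ : Q.obj Y = V)
    (h₃ : V = W) :
    Q.map (a ≫ eqToHom h) ≫ eqToHom h₁ = (Q.map a ≫ eqToHom h₂) ≫ eqToHom h₃ := by
  subst h h₁ h₂
  simp

lemma map_eqToHom_comp_inv {E : Type u₁} [Category.{v₁} E] {F : Type u₂} [Category.{v₂} F]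
    (Q : E ⥤ F) {X Y Z : E} {V : F} (a : X ≅ Y) (h : Z = Y) (h₁ : Q.obj Y = V)
    (h₂ : Q.obj Z = V) :
    Q.map (eqToHom h ≫ a.inv) ≫ Q.map a.hom ≫ eqToHom h₁ = eqToHom h₂ := by
  subst h h₁
  simp [← Functor.map_comp]

/-- Here the strictness of `ξ` enters: the sheaf of sets underlying `G_𝒳` is pulled back from the
base, so `ξ` contributes only an `eqToHom` there. -/
lemma underlying_map_abelianizeTwoIso (G : Sheaf J AddCommGrpCat.{u + 1}) :
    (underlying (topology J 𝒜)).map ((abelianizeTwoIso ξ).app ((pullbackFunctor J 𝒳).obj G)) =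
      (inducedMorphism J (toBase 𝒜)).inverse.map
          ((abelianizeForget x₀.inverse).hom.app ((pullbackFunctor J 𝒳).obj G)) ≫
        eqToHom (Functor.congr_obj (((inducedMorphism J (toBase 𝒜)).comp x₀).comm.trans
          (inducedMorphism J x).comm.symm) ((underlying J).obj G)) :=
  congrArg (fun t => (inducedMorphism J (toBase 𝒜)).inverse.map
    ((abelianizeForget x₀.inverse).hom.app ((pullbackFunctor J 𝒳).obj G)) ≫ t)
      (ξ.compat ((underlying J).obj G))

/-- This is the compatibility at the coefficient end of the `Ext` groups. It can be checked on
sheaves of sets, as the forgetful functor is faithful. -/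
lemma map_abelianizeComm (G : Sheaf J AddCommGrpCat.{u + 1}) :
    (pullbackAlong J (toBase 𝒜)).map ((abelianizeComm x₀).app G) ≫
        eqToHom (pullbackAlong_obj (toBase 𝒜) G) =
      (abelianizeTwoIso ξ).app ((pullbackFunctor J 𝒳).obj G) ≫
        eqToHom (pullbackAlong_obj x G) := by
  apply (underlying (topology J 𝒜)).map_injective
  have h : (underlying (topology J 𝒜)).map
      ((pullbackAlong J (toBase 𝒜)).map ((abelianizeComm x₀).app G)) =
        (inducedMorphism J (toBase 𝒜)).inverse.map
          ((abelianizeForget x₀.inverse).hom.app ((pullbackFunctor J 𝒳).obj G) ≫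
            (eqToHom x₀.comm).app ((underlying J).obj G)) := rfl
  rw [Functor.map_comp, Functor.map_comp, h, underlying_map_abelianizeTwoIso, eqToHom_map,
    eqToHom_map, eqToHom_app]
  exact map_comp_eqToHom _ _ _ _ _ _

/-- The counterpart at the source end, to be applied to the constant sheaf on `C`. -/
lemma map_abelianizeCommInv (G : Sheaf J AddCommGrpCat.{u + 1}) :
    (pullbackAlong J (toBase 𝒜)).map ((abelianizeCommInv x₀).app G) ≫
      (abelianizeTwoIso ξ).app ((pullbackFunctor J 𝒳).obj G) =
        eqToHom ((pullbackAlong_obj (toBase 𝒜) G).trans (pullbackAlong_obj x G).symm) := by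
  apply (underlying (topology J 𝒜)).map_injective
  have h : (underlying (topology J 𝒜)).map
      ((pullbackAlong J (toBase 𝒜)).map ((abelianizeCommInv x₀).app G)) =
        (inducedMorphism J (toBase 𝒜)).inverse.map
          ((eqToHom x₀.comm.symm).app ((underlying J).obj G) ≫
            (abelianizeForget x₀.inverse).inv.app ((pullbackFunctor J 𝒳).obj G)) := rfl
  refine (Functor.map_comp _ _ _).trans ?_
  rw [h, underlying_map_abelianizeTwoIso, eqToHom_map, eqToHom_app]
  exact map_eqToHom_comp_inv _ ((abelianizeForget x₀.inverse).app _) _ _ _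

end

/-! ### The inclusion for cohomology, and the theorem -/

section

variable {C : Type (u + 1)} [Category.{u} C] (J : GrothendieckTopology C)
  (𝒜 𝒳 : BasedCategory.{u, u + 1} C) [IsFiberedInGroupoids 𝒜.p] [IsFiberedInGroupoids 𝒳.p]

variable {𝒜 𝒳} in
lemma constantSheafPullbackIso_based (f : 𝒜 ⥤ᵇ 𝒳) (M : AddCommGrpCat.{u + 1}) :
    (constantSheafPullbackIso f.toFunctor (topology J 𝒜) (topology J 𝒳) M).hom ≫
        (pullbackAlong J f).map (constantSheafPullbackIso 𝒳.p (topology J 𝒳) J M).hom =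
      (constantSheafPullbackIso 𝒜.p (topology J 𝒜) J M).hom ≫
        eqToHom (pullbackAlong_obj f _).symm := by
  rw [← constantSheafPullbackIso_comp f.w (topology J 𝒜) (topology J 𝒳) J M]
  simp

lemma derivedCategory_le_cohomologyCategory (i : ℕ) :
    derivedCategory J 𝒜 𝒳 ≤ cohomologyCategory J 𝒜 𝒳 i := by
  rintro x ⟨x₀, ⟨ξ⟩⟩ G a
  -- Cohomology is `Ext` out of the constant sheaf with value `ULift ℤ`.
  let M := AddCommGrpCat.of (ULift.{u + 1} ℤ)
  refine exists_ext_of_natTrans (abelianize x₀.inverse) (pullbackAlong J (toBase 𝒜))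
    (pullbackAlong J x) (abelianizeTwoIso ξ)
    (cQ := (constantSheafPullbackIso (toBase 𝒜).toFunctor (topology J 𝒜)
      (topology J (base C)) M).hom)
    (cX := (constantSheafPullbackIso x.toFunctor (topology J 𝒜) (topology J 𝒳) M).hom)
    (d := eqToHom (pullbackAlong_obj x G))
    (d' := eqToHom (pullbackAlong_obj (toBase 𝒜) G))
    -- The comparison of `ℤ` on the base with `x₀^* ℤ_𝒳`, passing through `ℤ_C` pulled back to the
    -- base and `x₀^* p^* ℤ_C`.
    ((constantSheafPullbackIso (base C).p (topology J (base C)) J M).hom ≫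
      (abelianizeCommInv x₀).app _ ≫ (abelianize x₀.inverse).map
        (constantSheafPullbackIso 𝒳.p (topology J 𝒳) J M).inv)
    ((abelianizeComm x₀).app G)
    ?_ (map_abelianizeComm ξ G) a
  have h₁ := constantSheafPullbackIso_based J (toBase 𝒜) M
  have h₂ := constantSheafPullbackIso_based J x M
  have h₃ := (abelianizeTwoIso ξ).naturality (constantSheafPullbackIso 𝒳.p (topology J 𝒳) J M).inv
  have h₄ := map_abelianizeCommInv ξ ((constantSheaf J _).obj M)
  simp only [Functor.map_comp, Category.assoc]
  -- Naturality moves the inverse comparison on `𝒳` past `ξ`. Then `h₄` removes `ξ`, `h₁` and `h₂`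
  -- rewrite the route through the base as the route through `𝒳`, and the comparison on `𝒳` cancels
  -- its inverse.
  refine (congrArg (fun t => _ ≫ _ ≫ _ ≫ t) h₃).trans ?_
  rw [reassoc_of% h₄, reassoc_of% h₁, eqToHom_trans_assoc, ← reassoc_of% h₂, ← Functor.map_comp]
  simp

end

end DerivedObstruction

theorem proposition5p8 (S : AlgebraicGeometry.Scheme.{u})
    (𝒜 𝒳 : CategoryTheory.BasedCategory.{u, u + 1} (CategoryTheory.Over S))
    [DerivedObstruction.IsFiberedInGroupoids 𝒜.p]
    [DerivedObstruction.IsFiberedInGroupoids 𝒳.p] :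
    DerivedObstruction.derivedObstruction S 𝒜 𝒳 .fppf ≤
        DerivedObstruction.descentObstruction S 𝒜 𝒳 ∧
      ∀ (τ : DerivedObstruction.Topo) (i : ℕ),
        DerivedObstruction.derivedObstruction S 𝒜 𝒳 τ ≤
          DerivedObstruction.iDescentObstruction S 𝒜 𝒳 i τ := by
  exact ⟨DerivedObstruction.derivedCategory_le_torsorCategory _ 𝒜 𝒳,
    fun _ i => DerivedObstruction.derivedCategory_le_cohomologyCategory _ 𝒜 𝒳 i⟩
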